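/- For $n\ge 0$ let $$\xi_n=\sum_{k=0}^{n}(-1)^{n-k}\,3^{n-3k}\,\frac{(3k)!}{k!^3}\binom{n}{3k}\binom{n+k}{n}\in\mathbb{Z}$$ be the Almkvist–Zudilin numbers. Let $p$ be a prime number, let $f_\xi=\sum_{n\ge 0}\xi_n t^n\in\mathbb{F}_p[[t]]\subset\mathbb{F}_p((t))$ be the reduction modulo $p$ of their generating series, and let $$A_{\xi,p}=\sum_{n=0}^{p-1}\xi_n t^n\in\mathbb{F}_p[t].$$ Let $\mathbb{F}_p(t,f_\xi)\subset\mathbb{F}_p((t))$ be the field generated by $f_\xi$ over $\mathbb{F}_p(t)$, and let $S\subseteq\mathbb{F}_p^\times$ be the subgroup of squares. An equality $\mathrm{Gal}(\mathbb{F}_p(t,f_\xi)/\mathbb{F}_p(t))=H$ with a subgroup $H\subseteq\mathbb{F}_p^\times$ means that the extension is Galois, that $\sigma\mapsto\sigma(f_\xi)/f_\xi$ is an injective group homomorphism from its Galois group to $\mathbb{F}_p^\times$, and that the image of this homomorphism is $H$. Then there exists a polynomial $B_{\xi,p}\in\mathbb{F}_p[t]$ such that: - if $p\equiv 1,3\pmod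 8$, then $A_{\xi,p}=B_{\xi,p}^2$ and $\mathrm{Gal}(\mathbb{F}_p(t,f_\xi)/\mathbb{F}_p(t))=S$; - if $p\equiv 5,7\pmod 8$, then $A_{\xi,p}=(81t^2+14t+1)\,B_{\xi,p}^2$ and $\mathrm{Gal}(\mathbb{F}_p(t,f_\xi)/\mathbb{F}_p(t))=\mathbb{F}_p^\times$. -/

import Mathlib

open scoped Polynomial

/-- The multinomial quotient `(3k)! / (k!)^3` used below is an exact division. -/
theorem factorial_pow_three_dvd (k : ℕ) : k.factorial ^ 3 ∣ (3 * k).factorial := by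
  have h := Nat.prod_factorial_dvd_factorial_sum (Finset.univ : Finset (Fin 3)) (fun _ => k)
  simpa using h

/-- The Almkvist–Zudilin numbers
`ξ_n = ∑_{k=0}^n (-1)^(n-k) 3^(n-3k) (3k)!/(k!)^3 * binom(n, 3k) * binom(n+k, n)`.
When `n < 3k` the binomial coefficient `binom(n, 3k)` vanishes, so the truncated exponent
`n - 3k` plays no role in that range. -/
def azNumber (n : ℕ) : ℤ :=
  ∑ k ∈ Finset.range (n + 1),
    (-1 : ℤ) ^ (n - k) * 3 ^ (n - 3 * k) *
      (((3 * k).factorial / k.factorial ^ 3 : ℕ) : ℤ) * (n.choose (3 * k) : ℤ) *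
      ((n + k).choose n : ℤ)

/-- The reduction modulo `p` of the generating series of the Almkvist–Zudilin numbers,
as a formal power series. -/
def azPowerSeries (p : ℕ) : PowerSeries (ZMod p) :=
  PowerSeries.mk fun n => (azNumber n : ZMod p)

/-- The truncation at order `p` of the series, a polynomial over `𝔽_p`. -/
noncomputable def azTrunc (p : ℕ) : (ZMod p)[X] :=
  ∑ n ∈ Finset.range p, Polynomial.C (azNumber n : ZMod p) * Polynomial.X ^ n

/-- The series `f_ξ` modulo `p`, inside the field `𝔽_p((t))`, which contains `𝔽_p(t)`. -/
noncomputable def azSeries (p : ℕ) : LaurentSeries (ZMod p) :=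
  HahnSeries.ofPowerSeries ℤ (ZMod p) (azPowerSeries p)

/-- The inclusion of `𝔽_p(t)` in `𝔽_p((t))` (expansion at `t = 0`), which extends the inclusion
of `𝔽_p[t]`. This activates Mathlib's scoped instance for this pair of fields only. -/
noncomputable instance ratFuncLaurentAlgebra (p : ℕ) [Fact p.Prime] :
    Algebra (RatFunc (ZMod p)) (LaurentSeries (ZMod p)) :=
  RatFunc.liftAlgebra (ZMod p) (LaurentSeries (ZMod p))

/-- The field `𝔽_p(t, f_ξ)`, as the subfield of `𝔽_p((t))` generated by `f_ξ` over `𝔽_p(t)`. -/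
noncomputable def azField (p : ℕ) [Fact p.Prime] :
    IntermediateField (RatFunc (ZMod p)) (LaurentSeries (ZMod p)) :=
  IntermediateField.adjoin (RatFunc (ZMod p)) {azSeries p}

/-- The element `f_ξ` of `𝔽_p(t, f_ξ)`. -/
noncomputable def azGen (p : ℕ) [Fact p.Prime] : azField p :=
  ⟨azSeries p, IntermediateField.mem_adjoin_simple_self (RatFunc (ZMod p)) (azSeries p)⟩

/-- `Gal(𝔽_p(t, f_ξ)/𝔽_p(t)) = H` for a subgroup `H` of `𝔽_p^×`: the extension is Galois,
`σ ↦ σ(f_ξ)/f_ξ` is a well-defined injective group homomorphism from its Galois group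
to `𝔽_p^×`, and the image of this homomorphism is `H`. -/
def AZGaloisGroupIs (p : ℕ) [Fact p.Prime] (H : Subgroup (ZMod p)ˣ) : Prop :=
  IsGalois (RatFunc (ZMod p)) (azField p) ∧
    ∃ φ : (azField p ≃ₐ[RatFunc (ZMod p)] azField p) →* (ZMod p)ˣ,
      Function.Injective φ ∧
      (∀ σ : azField p ≃ₐ[RatFunc (ZMod p)] azField p,
        σ (azGen p) / azGen p =
          algebraMap (RatFunc (ZMod p)) (azField p) (RatFunc.C ((φ σ : (ZMod p)ˣ) : ZMod p))) ∧
      φ.range = H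

/-! Write F = ∑ (4k)!/(k!)^4 X^k and y = t³/(1+3t)⁴. Expanding powers of (1+3t)⁻¹ gives f_ξ =
(1+3t)⁻¹ F(y). Modulo p the coefficients of F satisfy a Lucas congruence, so F = F₀ F^p with F₀ the
truncation of F, of degree ⌊p/4⌋. Substituting y gives f_ξ = A f_ξ^p with A = (1+3t)^(p-1) F₀(y), a
polynomial of degree less than p, hence the truncation of f_ξ. Thus f_ξ^(p-1) = 1/A, and Kummer
theory applies since 𝔽_p^× is the group of (p-1)-th roots of unity: the Galois group embeds in
𝔽_p^×, and A is an e-th power, with e the index of the image.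

It remains to see how far A is a power. F₀ satisfies the third-order equation of F, a symmetric
square. The associated quadratic first integral has zero derivative and degree less than p, so it is
constant, and it vanishes at 0. Its leading term at an irreducible π forces the multiplicity of π in
F₀ to be 2 away from 1 - 256X, and 1 at 1 - 256X. So F₀ is a square up to 1 - 256X, and the parity
of ⌊p/4⌋, that is p mod 8, decides between the two cases. Under y, 1 - 256y becomes
(81t²+14t+1)(1-t)²/(1+3t)⁴, which gives the shape of A. The first integral pulls back to A as well,
and the same local analysis gives e ≤ 2, and e = 1 when 81t²+14t+1 divides A (for p > 3). -/

/-- For the operator `Q D² + (DQ / 2) D + S / 4`, the quadratic expression in `a` which vanishes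
when `a` is the square of a solution. -/
def firstIntegral {k R : Type*} [CommRing k] [CommRing R] [Algebra k R] (D : Derivation k R R)
    (Q S a : R) : R :=
  Q * (2 * a * D (D a) - D a ^ 2) + D Q * a * D a + S * a ^ 2

/-- The factor `u ^ 2` clears the exponents n - 1 and n - 2 that differentiating `u ^ n` produces,
so small n needs no separate treatment. -/
theorem sq_mul_firstIntegral_pow_mul {k R : Type*} [CommRing k] [CommRing R] [Algebra k R]
    (D : Derivation k R R) (Q S u E : R) (n : ℕ) :
    u ^ 2 * firstIntegral D Q S (u ^ n * E) = u ^ (2 * n) *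
      (Q * (2 * E * (n * (n - 1) * D u ^ 2 * E + 2 * n * u * D u * D E + n * u * D (D u) * E
        + u ^ 2 * D (D E)) - (n * D u * E + u * D E) ^ 2)
        + D Q * u * E * (n * D u * E + u * D E) + S * u ^ 2 * E ^ 2) := by
  have h1 : u * D (u ^ n) = n * u ^ n * D u := by
    cases n with
    | zero => simp
    | succ j =>
      rw [Derivation.leibniz_pow]
      simp only [add_tsub_cancel_right, nsmul_eq_mul, smul_eq_mul]
      ring
  have h2 : D u * D (u ^ n) + u * D (D (u ^ n)) =
      n * D (u ^ n) * D u + n * u ^ n * D (D u) := by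
    have := congrArg D h1
    simp only [Derivation.leibniz, smul_eq_mul, Derivation.map_natCast] at this
    linear_combination this
  rw [pow_mul' u 2 n]
  simp only [firstIntegral, Derivation.leibniz, smul_eq_mul, map_add]
  generalize D (D (u ^ n)) = v2 at *
  generalize D (u ^ n) = v1 at *
  generalize u ^ n = v at *
  linear_combination (2 * Q * v * E ^ 2) * (u * h2 + (n - 1) * D u * h1) +
    (4 * Q * v * E * D E * u - Q * E ^ 2 * (u * v1 + n * v * D u) - 2 * Q * v * E * D E * u
      + D Q * v * E ^ 2 * u) * h1

/-! ### Multiplicities of irreducible factors when the first integral vanishes -/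

namespace Polynomial

/-- The Euler operator `X d/dX` on polynomials. -/
noncomputable def euler (R : Type*) [CommRing R] : Derivation R R[X] R[X] :=
  (X : R[X]) • derivative'

theorem euler_apply {R : Type*} [CommRing R] (f : R[X]) : euler R f = X * derivative f := rfl

theorem coeff_euler {R : Type*} [CommRing R] (f : R[X]) (n : ℕ) :
    (euler R f).coeff n = n * f.coeff n := by
  rw [euler_apply]
  cases n with
  | zero => simp
  | succ n => rw [coeff_X_mul, coeff_derivative]; push_cast; ring

theorem natDegree_euler_le {R : Type*} [CommRing R] (f : R[X]) :
    (euler R f).natDegree ≤ f.natDegree := by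
  rw [natDegree_le_iff_coeff_eq_zero]
  intro n hn
  rw [coeff_euler, coeff_eq_zero_of_natDegree_lt hn, mul_zero]

section

variable {p : ℕ} [Fact p.Prime]

/-- Degree less than p makes π separable, and the nonzero constant term excludes π ~ X. -/
theorem not_dvd_euler_of_irreducible {π : (ZMod p)[X]} (hπ : Irreducible π)
    (hX : π.coeff 0 ≠ 0) (hdeg : π.natDegree < p) : ¬ π ∣ euler (ZMod p) π := by
  rw [euler_apply]
  intro h
  have hpos : 0 < π.natDegree := hπ.natDegree_pos
  rcases hπ.prime.dvd_or_dvd h with h | h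
  · have h' : Associated π X := hπ.associated_of_dvd irreducible_X h
    obtain ⟨c, hc⟩ := h'.symm.dvd
    exact hX (by rw [hc]; simp)
  · have h0 : derivative π ≠ 0 := by
      intro h0
      have hc := congrArg (fun f => f.coeff (π.natDegree - 1)) h0
      simp only [coeff_derivative, coeff_zero] at hc
      rw [Nat.sub_add_cancel hpos] at hc
      rcases mul_eq_zero.mp hc with hc | hc
      · exact hπ.ne_zero (leadingCoeff_eq_zero.mp hc)
      · have hc' : ((π.natDegree : ℕ) : ZMod p) = 0 := by
          rw [← hc, ← Nat.sub_add_cancel hpos]; push_cast; simp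
        rw [ZMod.natCast_eq_zero_iff] at hc'
        exact absurd (Nat.le_of_dvd hpos hc') (by omega)
    exact absurd (natDegree_le_of_dvd h h0) (by have := natDegree_derivative_lt hpos.ne'; omega)

variable {Q S A π E : (ZMod p)[X]} {k : ℕ}

/-- An indicial equation at π: the leading π-adic term of the first integral is proportional to
k(k-2) at ordinary points and to k(k-1) at simple zeros of Q. The degree bound gives k < p, so these
roots modulo p are genuine equalities. -/
theorem dvd_or_eq_of_firstIntegral_eq_zero (hA0 : A.coeff 0 ≠ 0) (hdeg : A.natDegree < p)
    (hI : firstIntegral (euler (ZMod p)) Q S A = 0) (hp : p ≠ 2)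
    (hπ : Irreducible π) (hA : A = π ^ k * E) (hE : ¬ π ∣ E) (hk : k ≠ 0) :
    (π ∣ Q ∨ k = 2) ∧ (π ∣ Q → ¬ π ^ 2 ∣ Q → k = 1) := by
  have hA' : A ≠ 0 := by rintro rfl; simp at hA0
  have hE0 : E ≠ 0 := by rintro rfl; simp at hE
  have hp2 : 2 < p := lt_of_le_of_ne (Fact.out : p.Prime).two_le (Ne.symm hp)
  have hdegA : A.natDegree = k * π.natDegree + E.natDegree := by
    rw [hA, natDegree_mul (pow_ne_zero _ hπ.ne_zero) hE0, natDegree_pow]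
  have hpos : 0 < π.natDegree := hπ.natDegree_pos
  have hkp : k < p := by nlinarith
  have hπp : π.natDegree < p := by
    have : 1 ≤ k := Nat.one_le_iff_ne_zero.mpr hk
    nlinarith
  have hX : π.coeff 0 ≠ 0 := by
    intro h
    apply hA0
    rw [hA, mul_coeff_zero, coeff_zero_eq_eval_zero, eval_pow, ← coeff_zero_eq_eval_zero, h,
      zero_pow hk, zero_mul]
  have hD := not_dvd_euler_of_irreducible hπ hX hπp
  have key := sq_mul_firstIntegral_pow_mul (euler (ZMod p)) Q S π E k
  rw [← hA, hI, mul_zero] at key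
  have hJ := (mul_eq_zero.mp key.symm).resolve_left (pow_ne_zero _ hπ.ne_zero)
  have hconst : ∀ j : ℕ, j ≤ k → π ∣ ((k - j : ℕ) : ZMod p) • (1 : (ZMod p)[X]) →
      k = j := by
    intro j hj h
    rw [smul_eq_C_mul, mul_one] at h
    by_contra hne
    have hne0 : ((k - j : ℕ) : ZMod p) ≠ 0 := by
      rw [Ne, ZMod.natCast_eq_zero_iff]
      intro hd
      have := Nat.le_of_dvd (by omega) hd
      omega
    exact hπ.not_isUnit (isUnit_of_dvd_unit h (isUnit_C.mpr (isUnit_iff_ne_zero.mpr hne0)))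
  have hk0 : ¬ π ∣ (k : (ZMod p)[X]) := by
    intro h
    exact hk (hconst 0 (Nat.zero_le _) (by simpa [smul_eq_C_mul] using h))
  have hmul : ∀ {a b : (ZMod p)[X]}, ¬ π ∣ a → π ∣ a * b → π ∣ b := fun ha h =>
    (hπ.prime.dvd_or_dvd h).resolve_left ha
  have hsq : ∀ {a : (ZMod p)[X]}, ¬ π ∣ a → ¬ π ∣ a ^ 2 := fun ha h =>
    ha (hπ.prime.dvd_of_dvd_pow h)
  set d := euler (ZMod p) π with hd
  constructor
  · by_contra! hcon
    obtain ⟨hQ, hk2⟩ := hcon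
    -- Modulo π only 2k(k-1) - k² = k(k-2) times Q d² E² survives in `hJ`.
    have h1 : π ∣ d ^ 2 * (E ^ 2 * (k * (Q * (k - 2)))) := by
      refine ⟨-(Q * (2 * E * (2 * k * d * euler (ZMod p) E + k * euler (ZMod p) d * E +
        π * euler (ZMod p) (euler (ZMod p) E)) - 2 * k * d * E * euler (ZMod p) E -
        π * euler (ZMod p) E ^ 2) + euler (ZMod p) Q * E * (k * d * E + π * euler (ZMod p) E)
        + S * π * E ^ 2), ?_⟩
      linear_combination hJ
    have h2 := hmul hQ (hmul hk0 (hmul (hsq hE) (hmul (hsq hD) h1)))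
    rcases Nat.lt_or_ge k 2 with hlt | hge
    · obtain rfl : k = 1 := by omega
      apply hπ.not_isUnit
      refine isUnit_of_dvd_unit h2 ?_
      rw [show ((1 : ℕ) : (ZMod p)[X]) - 2 = -1 by push_cast; ring]
      exact isUnit_one.neg
    · exact hk2 (hconst 2 hge (by
        rw [smul_eq_C_mul, mul_one, Nat.cast_sub hge, Nat.cast_ofNat, map_sub, map_ofNat, map_natCast]
        exact h2))
  · rintro ⟨R, rfl⟩ hR
    have hR' : ¬ π ∣ R := fun h => hR (by rw [sq]; exact mul_dvd_mul_left _ h)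
    have hJ' := hJ
    simp only [Derivation.leibniz, smul_eq_mul, ← hd] at hJ'
    -- With Q = πR, the term in `D Q` adds k R d² E² after division by π, turning k(k-2) into
    -- k(k-1).
    have h1 : π ∣ d ^ 2 * (E ^ 2 * (k * (R * (k - 1)))) := by
      refine ⟨-(R * (2 * E * (2 * k * d * euler (ZMod p) E + k * euler (ZMod p) d * E +
        π * euler (ZMod p) (euler (ZMod p) E)) - 2 * k * d * E * euler (ZMod p) E -
        π * euler (ZMod p) E ^ 2) + euler (ZMod p) R * E * (k * d * E + π * euler (ZMod p) E)
        + R * d * E * euler (ZMod p) E + S * E ^ 2), ?_⟩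
      apply mul_left_cancel₀ hπ.ne_zero
      linear_combination hJ'
    have h2 := hmul hR' (hmul hk0 (hmul (hsq hE) (hmul (hsq hD) h1)))
    have hk1 : 1 ≤ k := Nat.one_le_iff_ne_zero.mpr hk
    exact hconst 1 hk1 (by
        rw [smul_eq_C_mul, mul_one, Nat.cast_sub hk1]; simpa using h2)

end

theorem exists_sq_mul_squarefree {F : Type*} [Field F] (A : F[X]) (hA : A ≠ 0) :
    ∃ G f : F[X], A = G ^ 2 * f ∧ Squarefree f := by
  induction hn : A.natDegree using Nat.strong_induction_on generalizing A with
  | _ n ih =>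
    by_cases hsq : Squarefree A
    · exact ⟨1, A, by simp, hsq⟩
    · rw [squarefree_iff_irreducible_sq_not_dvd_of_ne_zero hA] at hsq
      push Not at hsq
      obtain ⟨x, hx, B, rfl⟩ := hsq
      have hB : B ≠ 0 := by rintro rfl; simp at hA
      have hdeg : (x * x * B).natDegree = x.natDegree + x.natDegree + B.natDegree := by
        rw [natDegree_mul (mul_ne_zero hx.ne_zero hx.ne_zero) hB,
          natDegree_mul hx.ne_zero hx.ne_zero]
      obtain ⟨G, f, rfl, hf⟩ := ih B.natDegree (by have := hx.natDegree_pos; omega) B hB rfl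
      exact ⟨x * G, f, by ring, hf⟩

end Polynomial

/-! ### The numbers (4k)!/(k!)^4 and their Lucas congruence -/

section

/-- The multinomial coefficients `(4k)! / (k!)^4`. -/
def quarticCoeff (k : ℕ) : ℕ := (2 * k).centralBinom * k.centralBinom ^ 2

theorem quarticCoeff_mul_factorial_pow (k : ℕ) :
    quarticCoeff k * k.factorial ^ 4 = (4 * k).factorial := by
  have h1 := Nat.choose_mul_factorial_mul_factorial (show k ≤ 2 * k by omega)
  have h2 := Nat.choose_mul_factorial_mul_factorial (show 2 * k ≤ 2 * (2 * k) by omega)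
  rw [show 2 * k - k = k by omega] at h1
  rw [show 2 * (2 * k) - 2 * k = 2 * k by omega] at h2
  rw [show 4 * k = 2 * (2 * k) by ring, quarticCoeff, Nat.centralBinom, Nat.centralBinom, ← h2, ← h1]
  ring

theorem quarticCoeff_succ (k : ℕ) :
    (k + 1) ^ 3 * quarticCoeff (k + 1) =
      8 * (4 * k + 1) * (2 * k + 1) * (4 * k + 3) * quarticCoeff k := by
  have h1 := Nat.succ_mul_centralBinom_succ k
  have h2 := Nat.succ_mul_centralBinom_succ (2 * k)
  have h3 := Nat.succ_mul_centralBinom_succ (2 * k + 1)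
  rw [quarticCoeff, quarticCoeff, show 2 * (k + 1) = 2 * k + 1 + 1 by ring]
  have hpos : 0 < 2 * (2 * k + 1) := by omega
  apply Nat.eq_of_mul_eq_mul_left hpos
  generalize Nat.centralBinom (2 * k + 1 + 1) = c at *
  generalize Nat.centralBinom (2 * k + 1) = b at *
  generalize Nat.centralBinom (2 * k) = a at *
  generalize Nat.centralBinom (k + 1) = e at *
  generalize Nat.centralBinom k = d at *
  zify at *
  linear_combination (2 * k + 1) * (k + 1) ^ 2 * e ^ 2 * h3
    + 2 * (4 * k + 3) * (k + 1) ^ 2 * e ^ 2 * h2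
    + 2 * (4 * k + 3) * 2 * (4 * k + 1) * a * ((k + 1) * e + 2 * (2 * k + 1) * d) * h1

section

variable {p : ℕ} [Fact p.Prime]

/-- Lucas' theorem; if doubling a produces a carry in base p, both sides vanish. -/
theorem centralBinom_add_mul_cast (a b : ℕ) (ha : a < p) :
    ((a + p * b).centralBinom : ZMod p) = a.centralBinom * b.centralBinom := by
  have hp : 0 < p := (Fact.out : p.Prime).pos
  have key (n k : ℕ) : ((n.choose k : ℕ) : ZMod p) =
      ((n % p).choose (k % p) : ℕ) * ((n / p).choose (k / p) : ℕ) := by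
    have := (ZMod.natCast_eq_natCast_iff _ _ p).mpr
      (Choose.choose_modEq_choose_mod_mul_choose_div_nat (n := n) (k := k) (p := p))
    rw [this]; push_cast; rfl
  rw [Nat.centralBinom, Nat.centralBinom, Nat.centralBinom, key]
  have e1 : (a + p * b) % p = a := by rw [Nat.add_mul_mod_self_left, Nat.mod_eq_of_lt ha]
  have e2 : (a + p * b) / p = b := by
    rw [Nat.add_mul_div_left _ _ hp, Nat.div_eq_of_lt ha, zero_add]
  have e3 : 2 * (a + p * b) = 2 * a + p * (2 * b) := by ring
  rw [e1, e2, e3, Nat.add_mul_mod_self_left, Nat.add_mul_div_left _ _ hp]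
  rcases Nat.lt_or_ge (2 * a) p with h | h
  · rw [Nat.mod_eq_of_lt h, Nat.div_eq_of_lt h, zero_add]
  · have h' : 2 * a % p < a := by
      rw [Nat.mod_eq_sub_mod h, Nat.mod_eq_of_lt (by omega)]; omega
    rw [Nat.choose_eq_zero_of_lt h', key (2 * a) a, Nat.mod_eq_of_lt ha,
      Nat.choose_eq_zero_of_lt h']
    simp

theorem centralBinom_cast_eq_zero {a : ℕ} (ha : a < p) (h : p ≤ 2 * a) :
    (a.centralBinom : ZMod p) = 0 := by
  rw [ZMod.natCast_eq_zero_iff]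
  have := (Fact.out : p.Prime).dvd_choose_add ha ha (by omega)
  rwa [← two_mul] at this

theorem quarticCoeff_add_mul_cast (a b : ℕ) (ha : a < p) :
    (quarticCoeff (a + p * b) : ZMod p) = quarticCoeff a * quarticCoeff b := by
  simp only [quarticCoeff, Nat.cast_mul, Nat.cast_pow, centralBinom_add_mul_cast a b ha]
  rcases Nat.lt_or_ge (2 * a) p with h | h
  · rw [show 2 * (a + p * b) = 2 * a + p * (2 * b) by ring, centralBinom_add_mul_cast _ _ h]
    ring
  · rw [centralBinom_cast_eq_zero ha h]
    ring

/-- Hence truncating at order p is the same as truncating after degree ⌊p/4⌋, which keeps the first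
integral of degree less than p. -/
theorem quarticCoeff_cast_eq_zero {k : ℕ} (hk : k < p) (h : p / 4 < k) :
    (quarticCoeff k : ZMod p) = 0 := by
  simp only [quarticCoeff, Nat.cast_mul, Nat.cast_pow]
  rcases Nat.lt_or_ge (2 * k) p with h' | h'
  · rw [centralBinom_cast_eq_zero h' (by omega)]; ring
  · rw [centralBinom_cast_eq_zero hk h']; ring

theorem quarticCoeff_cast_ne_zero {k : ℕ} (h : k ≤ p / 4) : (quarticCoeff k : ZMod p) ≠ 0 := by
  have hp : p.Prime := Fact.out
  rw [Ne, ZMod.natCast_eq_zero_iff]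
  intro hd
  have h4 : 4 * k < p := by
    rcases Nat.lt_or_ge (4 * k) p with h' | h'
    · exact h'
    · have : p = 4 * k := by omega
      have h2 : 2 ∣ p := by omega
      have := (Nat.prime_dvd_prime_iff_eq Nat.prime_two hp).mp h2
      omega
  have := (hp.dvd_factorial).mp ((quarticCoeff_mul_factorial_pow k) ▸ hd.mul_right (k.factorial ^ 4))
  omega

end

/-! ### The truncation modulo p: differential equation and factorization -/

open Polynomial

/-- The truncation at order `p` of the series `∑ (4k)! / (k!)^4 X^k` modulo `p`. -/
noncomputable def quarticTrunc (p : ℕ) : (ZMod p)[X] :=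
  ∑ k ∈ Finset.range (p / 4 + 1), C (quarticCoeff k : ZMod p) * X ^ k

section

variable {p : ℕ} [Fact p.Prime]

theorem coeff_quarticTrunc (n : ℕ) :
    (quarticTrunc p).coeff n = if n ≤ p / 4 then (quarticCoeff n : ZMod p) else 0 := by
  simp [quarticTrunc, coeff_X_pow]

theorem coeff_quarticTrunc_of_lt {n : ℕ} (hn : n < p) :
    (quarticTrunc p).coeff n = quarticCoeff n := by
  rw [coeff_quarticTrunc]
  split_ifs with h
  · rfl
  · rw [quarticCoeff_cast_eq_zero hn (by omega)]

theorem natDegree_quarticTrunc : (quarticTrunc p).natDegree = p / 4 := by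
  apply le_antisymm
  · rw [natDegree_le_iff_coeff_eq_zero]
    intro n hn
    rw [coeff_quarticTrunc, if_neg (by omega)]
  · apply le_natDegree_of_ne_zero
    rw [coeff_quarticTrunc, if_pos le_rfl]
    exact quarticCoeff_cast_ne_zero le_rfl

theorem coeff_zero_quarticTrunc : (quarticTrunc p).coeff 0 = 1 := by
  rw [coeff_quarticTrunc, if_pos (Nat.zero_le _)]
  simp [quarticCoeff]

/-- The recurrence survives truncation: at n + 1 = p the factor (n + 1)³ is zero modulo p, and the
coefficient of index p - 1 is already zero. -/
theorem coeff_succ_quarticTrunc (hp : p ≠ 2) (n : ℕ) :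
    ((n : ZMod p) + 1) ^ 3 * (quarticTrunc p).coeff (n + 1) =
      8 * (4 * n + 1) * (2 * n + 1) * (4 * n + 3) * (quarticTrunc p).coeff n := by
  have hp2 : 2 < p := lt_of_le_of_ne (Fact.out : p.Prime).two_le (Ne.symm hp)
  rcases lt_trichotomy (n + 1) p with h | h | h
  · rw [coeff_quarticTrunc_of_lt h, coeff_quarticTrunc_of_lt (by omega)]
    exact_mod_cast congrArg (Nat.cast (R := ZMod p)) (quarticCoeff_succ n)
  · rw [coeff_quarticTrunc, coeff_quarticTrunc, if_neg (by omega), if_neg (by omega)]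
    ring
  · rw [coeff_quarticTrunc, coeff_quarticTrunc, if_neg (by omega), if_neg (by omega)]
    ring

theorem euler_quarticTrunc (hp : p ≠ 2) :
    euler (ZMod p) (euler (ZMod p) (euler (ZMod p) (quarticTrunc p))) =
      X * (256 * euler (ZMod p) (euler (ZMod p) (euler (ZMod p) (quarticTrunc p)))
        + 384 * euler (ZMod p) (euler (ZMod p) (quarticTrunc p))
        + 176 * euler (ZMod p) (quarticTrunc p) + 24 * quarticTrunc p) := by
  have hc (r : ℕ) [r.AtLeastTwo] : (OfNat.ofNat r : (ZMod p)[X]) = C (OfNat.ofNat r : ZMod p) :=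
    (map_ofNat C r).symm
  rw [hc 256, hc 384, hc 176, hc 24]
  ext n
  cases n with
  | zero => simp [coeff_euler]
  | succ n =>
    simp only [coeff_X_mul, coeff_euler, coeff_add, coeff_C_mul]
    push_cast
    linear_combination coeff_succ_quarticTrunc hp n

theorem firstIntegral_quarticTrunc (hp : p ≠ 2) :
    firstIntegral (euler (ZMod p)) (1 - 256 * X) (-48 * X) (quarticTrunc p) = 0 := by
  have hp2 : 2 < p := lt_of_le_of_ne (Fact.out : p.Prime).two_le (Ne.symm hp)
  have hX : euler (ZMod p) X = X := by simp [euler_apply]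
  have hc (r : ℕ) [r.AtLeastTwo] : euler (ZMod p) (OfNat.ofNat r : (ZMod p)[X]) = 0 :=
    (euler (ZMod p)).map_natCast r
  have hQ : euler (ZMod p) (1 - 256 * X) = -256 * X := by
    simp [hX, hc]
  have hD : euler (ZMod p)
      (firstIntegral (euler (ZMod p)) (1 - 256 * X) (-48 * X) (quarticTrunc p)) = 0 := by
    have h := euler_quarticTrunc hp
    simp only [firstIntegral, hQ]
    simp only [map_add, map_sub, map_neg, Derivation.leibniz, Derivation.leibniz_pow, hX, hc,
      smul_eq_mul, Derivation.map_one_eq_zero, nsmul_eq_mul]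
    generalize euler (ZMod p) (euler (ZMod p) (euler (ZMod p) (quarticTrunc p))) = h3 at *
    generalize euler (ZMod p) (euler (ZMod p) (quarticTrunc p)) = h2 at *
    generalize euler (ZMod p) (quarticTrunc p) = h1 at *
    generalize quarticTrunc p = h0 at *
    push_cast
    -- The derivative of the first integral is 2a times the third-order equation.
    linear_combination (2 * h0) * h
  have hdeg : (firstIntegral (euler (ZMod p)) (1 - 256 * X) (-48 * X)
      (quarticTrunc p)).natDegree < p := by
    have h0 : (quarticTrunc p).natDegree ≤ p / 4 := natDegree_quarticTrunc.le
    have h1 := (natDegree_euler_le (quarticTrunc p)).trans h0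
    have h2 := (natDegree_euler_le (euler (ZMod p) (quarticTrunc p))).trans h1
    have : (firstIntegral (euler (ZMod p)) (1 - 256 * X) (-48 * X)
      (quarticTrunc p)).natDegree ≤ 1 + (p / 4 + p / 4) := by
      rw [firstIntegral, hQ]
      generalize euler (ZMod p) (euler (ZMod p) (quarticTrunc p)) = h2 at *
      generalize euler (ZMod p) (quarticTrunc p) = h1 at *
      have hl (r : ℕ) : ((r : (ZMod p)[X]) * X).natDegree ≤ 1 := by
        rw [← map_natCast C]; exact (natDegree_C_mul_le _ _).trans natDegree_X_le
      have hl1 : (1 - 256 * X : (ZMod p)[X]).natDegree ≤ 1 :=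
        (natDegree_sub_le _ _).trans (max_le (by simp) (by simpa using hl 256))
      have hl2 : (-256 * X : (ZMod p)[X]).natDegree ≤ 1 := by
        rw [neg_mul, natDegree_neg]; simpa using hl 256
      have hl3 : (-48 * X : (ZMod p)[X]).natDegree ≤ 1 := by
        rw [neg_mul, natDegree_neg]; simpa using hl 48
      have hprod {a b : (ZMod p)[X]} (ha : a.natDegree ≤ p / 4) (hb : b.natDegree ≤ p / 4) :
        (a * b).natDegree ≤ p / 4 + p / 4 := natDegree_mul_le_of_le ha hb
      refine natDegree_add_le_of_degree_le (natDegree_add_le_of_degree_le ?_ ?_) ?_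
      · refine natDegree_mul_le_of_le hl1 ((natDegree_sub_le _ _).trans (max_le ?_ ?_))
        · rw [mul_assoc, ← map_ofNat C 2]
          exact (natDegree_C_mul_le _ _).trans (hprod h0 h2)
        · rw [sq]; exact hprod h1 h1
      · rw [mul_assoc]
        exact natDegree_mul_le_of_le hl2 (hprod h0 h1)
      · rw [sq]
        exact natDegree_mul_le_of_le hl3 (hprod h0 h0)
    omega
  ext n
  rw [coeff_zero]
  have hn := congrArg (fun f => f.coeff n) hD
  simp only [coeff_euler, coeff_zero] at hn
  -- A zero Euler derivative kills the coefficients with 0 < n < p; the constant term is zero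
  -- because Euler derivatives and -48X vanish at 0.
  rcases Nat.lt_or_ge n p with hlt | hge
  · rcases Nat.eq_zero_or_pos n with rfl | hpos
    · simp [firstIntegral, coeff_zero_eq_eval_zero, euler_apply]
    · refine (mul_eq_zero.mp hn).resolve_left ?_
      rw [ZMod.natCast_eq_zero_iff]
      intro hd
      have := Nat.le_of_dvd hpos hd
      omega
  · exact coeff_eq_zero_of_natDegree_lt (by omega)

theorem two_ne_zero_zmod (hp : p ≠ 2) : (2 : ZMod p) ≠ 0 := by
  have hp2 : 2 < p := lt_of_le_of_ne (Fact.out : p.Prime).two_le (Ne.symm hp)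
  have h2 : ((2 : ℕ) : ZMod p) ≠ 0 := by
    rw [Ne, ZMod.natCast_eq_zero_iff]
    intro h
    have := Nat.le_of_dvd two_pos h
    omega
  simpa using h2

theorem natDegree_one_sub_mul_X (hp : p ≠ 2) : (1 - 256 * X : (ZMod p)[X]).natDegree = 1 := by
  have h256 : (256 : ZMod p) ≠ 0 := by
    rw [show (256 : ZMod p) = 2 ^ 8 by norm_num]
    exact pow_ne_zero _ (two_ne_zero_zmod hp)
  rw [← map_ofNat C 256, sub_eq_neg_add, ← neg_mul, ← C_neg, ← C_1]
  exact natDegree_linear (neg_ne_zero.mpr h256)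

/-- The truncation is a square, up to the factor `1 - 256 X` when its degree is odd. -/
theorem exists_quarticTrunc_eq (hp : p ≠ 2) :
    ∃ G : (ZMod p)[X], (Even (p / 4) → quarticTrunc p = G ^ 2) ∧
      (Odd (p / 4) → quarticTrunc p = (1 - 256 * X) * G ^ 2) := by
  have hp2 : 2 < p := lt_of_le_of_ne (Fact.out : p.Prime).two_le (Ne.symm hp)
  have h0 : quarticTrunc p ≠ 0 := by
    intro h
    have := coeff_zero_quarticTrunc (p := p)
    rw [h] at this
    simp at this
  have hQdeg := natDegree_one_sub_mul_X hp
  have hQirr : Irreducible (1 - 256 * X : (ZMod p)[X]) :=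
    irreducible_of_degree_eq_one (by
      rw [degree_eq_natDegree (by intro h; simp [h] at hQdeg), hQdeg]; rfl)
  obtain ⟨G, f, hGf, hf⟩ := exists_sq_mul_squarefree _ h0
  have hG0 : G ≠ 0 := by rintro rfl; simp [hGf] at h0
  have hf0 : f ≠ 0 := hf.ne_zero
  -- A factor of the squarefree part has odd multiplicity, so not 2, and must divide 1 - 256X.
  have hdvd : ∀ π : (ZMod p)[X], Irreducible π → π ∣ f → π ∣ 1 - 256 * X := by
    rintro π hπ ⟨g, rfl⟩
    have hg : ¬ π ∣ g := by
      rintro ⟨g', rfl⟩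
      exact hπ.not_isUnit (hf π ⟨g', by ring⟩)
    obtain ⟨G', hG', hGj⟩ :=
      (FiniteMultiplicity.of_prime_left hπ.prime hG0).exists_eq_pow_mul_and_not_dvd
    generalize multiplicity π G = j at hG'
    have hA : quarticTrunc p = π ^ (2 * j + 1) * (G' ^ 2 * g) := by
      rw [hGf, hG']; ring
    have hE : ¬ π ∣ G' ^ 2 * g := fun h => (hπ.prime.dvd_or_dvd h).elim
      (fun h => hGj (hπ.prime.dvd_of_dvd_pow h)) hg
    refine (dvd_or_eq_of_firstIntegral_eq_zero (by rw [coeff_zero_quarticTrunc]; exact one_ne_zero)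
      (by rw [natDegree_quarticTrunc]; omega) (firstIntegral_quarticTrunc hp) hp hπ hA hE
      (by omega)).1.resolve_right (by omega)
  have hunit : ∀ g : (ZMod p)[X], (∀ π : (ZMod p)[X], Irreducible π → ¬ π ∣ g) →
      ∃ c : ZMod p, g = C c := by
    intro g hg
    refine ⟨_, eq_C_of_natDegree_eq_zero ?_⟩
    by_contra hdeg
    obtain ⟨π, hπ, hd⟩ := exists_irreducible_of_natDegree_ne_zero hdeg
    exact hg π hπ hd
  have hform : ∃ c : ZMod p, f = C c ∨ f = (1 - 256 * X) * C c := by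
    by_cases hQf : (1 - 256 * X) ∣ f
    · obtain ⟨g, rfl⟩ := hQf
      obtain ⟨c, rfl⟩ := hunit g (by
        intro π hπ hd
        exact hπ.not_isUnit (hf π (mul_dvd_mul (hdvd π hπ (hd.mul_left _)) hd)))
      exact ⟨c, Or.inr rfl⟩
    · obtain ⟨c, rfl⟩ := hunit f (by
        intro π hπ hd
        exact hQf ((hπ.associated_of_dvd hQirr (hdvd π hπ hd)).symm.dvd.trans hd))
      exact ⟨c, Or.inl rfl⟩
  have hone := coeff_zero_quarticTrunc (p := p)
  rw [hGf, coeff_zero_eq_eval_zero] at hone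
  have hdeg := natDegree_quarticTrunc (p := p)
  rw [hGf, natDegree_mul (pow_ne_zero _ hG0) hf0, natDegree_pow] at hdeg
  obtain ⟨c, rfl | rfl⟩ := hform
  · have hc : eval 0 G ^ 2 * c = 1 := by simpa using hone
    rw [natDegree_C, add_zero] at hdeg
    -- The constant term 1 gives c G(0)² = 1, so c = (c G(0))² is absorbed into the square.
    refine ⟨C (c * eval 0 G) * G, fun _ => ?_, fun h => ?_⟩
    · rw [hGf, mul_pow, ← C_pow, show (c * eval 0 G) ^ 2 = c by linear_combination c * hc, mul_comm]
    · rw [← hdeg] at h; exact absurd h (by simp)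
  · have hc : eval 0 G ^ 2 * c = 1 := by simpa using hone
    have hc0 : c ≠ 0 := by rintro rfl; simp at hc
    rw [natDegree_mul_C hc0, hQdeg] at hdeg
    refine ⟨C (c * eval 0 G) * G, fun h => ?_, fun _ => ?_⟩
    · rw [← hdeg] at h; exact absurd h (by simp [parity_simps])
    · rw [hGf, mul_pow, ← C_pow, show (c * eval 0 G) ^ 2 = c by linear_combination c * hc]
      ring

end

end

/-! ### The Almkvist–Zudilin series as a pullback of the quartic series -/

section

/-- Both sides equal (n+k)! / (k!^4 (n-3k)!). The right side exhibits a coefficient of X^(3k)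
(1+3X)^(-4k-1), up to a power of -3. -/
theorem azNumber_summand {n k : ℕ} (h : 3 * k ≤ n) :
    (3 * k).factorial / k.factorial ^ 3 * n.choose (3 * k) * (n + k).choose n =
      quarticCoeff k * (n + k).choose (4 * k) := by
  have h1 := Nat.choose_mul_factorial_mul_factorial h
  have h2 := Nat.choose_mul_factorial_mul_factorial (show n ≤ n + k by omega)
  have h3 := Nat.choose_mul_factorial_mul_factorial (show 4 * k ≤ n + k by omega)
  rw [show n + k - n = k by omega] at h2
  rw [show n + k - 4 * k = n - 3 * k by omega] at h3
  have h4 := Nat.div_mul_cancel (factorial_pow_three_dvd k)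
  have h5 := quarticCoeff_mul_factorial_pow k
  have hpos : 0 < k.factorial ^ 4 * (n - 3 * k).factorial := by positivity
  apply Nat.eq_of_mul_eq_mul_right hpos
  generalize (3 * k).factorial / k.factorial ^ 3 = q at *
  calc q * n.choose (3 * k) * (n + k).choose n * (k.factorial ^ 4 * (n - 3 * k).factorial)
      = (n + k).choose n * (n.choose (3 * k) * (q * k.factorial ^ 3) * (n - 3 * k).factorial)
          * k.factorial := by ring
    _ = (n + k).choose (4 * k) * (quarticCoeff k * k.factorial ^ 4) * (n - 3 * k).factorial := by
        rw [h4, h1, h2, h5, h3]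
    _ = _ := by ring

theorem azNumber_eq_sum (n : ℕ) :
    azNumber n = ∑ k ∈ Finset.range (n + 1), if 3 * k ≤ n then
      (quarticCoeff k : ℤ) * ((-3) ^ (n - 3 * k) * ((n + k).choose (4 * k) : ℤ)) else 0 := by
  refine Finset.sum_congr rfl fun k hk => ?_
  split_ifs with h
  · have hs : (-1 : ℤ) ^ (n - k) = (-1) ^ (n - 3 * k) := by
      rw [show n - k = n - 3 * k + 2 * k by omega, pow_add, pow_mul]; simp
    have := congrArg (Nat.cast (R := ℤ)) (azNumber_summand h)
    push_cast at this
    rw [hs, show (-3 : ℤ) = (-1) * 3 by norm_num, mul_pow]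
    push_cast
    linear_combination ((-1) ^ (n - 3 * k) * 3 ^ (n - 3 * k)) * this
  · rw [Nat.choose_eq_zero_of_lt (by omega : n < 3 * k)]
    simp

open PowerSeries

/-- The power series `(1 + 3X)⁻¹`. -/
noncomputable def invOneAdd (R : Type*) [CommRing R] : R⟦X⟧ := mk fun n => (-3) ^ n

theorem invOneAdd_mul (R : Type*) [CommRing R] : invOneAdd R * (1 + 3 * X) = 1 := by
  ext n
  rw [mul_add, mul_one, ← mul_assoc, mul_comm _ (3 : R⟦X⟧), ← map_ofNat (C (R := R)) 3]
  cases n with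
  | zero => simp [invOneAdd]
  | succ n =>
    rw [map_add, coeff_succ_mul_X, coeff_C_mul, invOneAdd, coeff_mk, coeff_mk, coeff_one,
      if_neg (by omega)]
    ring

theorem coeff_invOneAdd_pow (R : Type*) [CommRing R] (d n : ℕ) :
    coeff n (invOneAdd R ^ (d + 1)) = (-3) ^ n * ((d + n).choose d : R) := by
  have h := congrArg (rescale (-3 : R)) (mk_add_choose_mul_one_sub_pow_eq_one R d)
  rw [map_mul, map_pow, map_sub, map_one, rescale_X, map_neg, map_ofNat, neg_mul,
    sub_neg_eq_add] at h
  have h2 : invOneAdd R ^ (d + 1) = rescale (-3 : R) (mk fun n ↦ ((d + n).choose d : R)) := by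
    calc invOneAdd R ^ (d + 1) = _ * (1 + 3 * X) ^ (d + 1) * invOneAdd R ^ (d + 1) := by
          rw [h, one_mul]
      _ = _ * (invOneAdd R * (1 + 3 * X)) ^ (d + 1) := by rw [mul_pow]; ring
      _ = _ := by rw [invOneAdd_mul, one_pow, mul_one]
  rw [h2, coeff_rescale, coeff_mk]

/-- The power series `X³ / (1 + 3X)⁴`. -/
noncomputable def azParam (R : Type*) [CommRing R] : R⟦X⟧ := X ^ 3 * invOneAdd R ^ 4

theorem hasSubst_azParam (R : Type*) [CommRing R] : HasSubst (azParam R) :=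
  HasSubst.of_constantCoeff_zero (by
    change constantCoeff (azParam R) = 0
    simp [azParam])

/-- The power series `∑ (4k)! / (k!)^4 X^k` modulo `p`. -/
noncomputable def quarticSeries (p : ℕ) : (ZMod p)⟦X⟧ := mk fun k => (quarticCoeff k : ZMod p)

theorem azPowerSeries_eq_subst (p : ℕ) :
    azPowerSeries p = invOneAdd (ZMod p) * (quarticSeries p).subst (azParam (ZMod p)) := by
  have hy := hasSubst_azParam (ZMod p)
  ext n
  rw [azPowerSeries, coeff_mk, azNumber_eq_sum, eq_X_pow_mul_shift_add_trunc (n + 1) (quarticSeries p),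
    subst_add hy, subst_mul hy, subst_pow hy, subst_X hy, subst_coe hy, mul_add, map_add]
  have hz : coeff n (invOneAdd (ZMod p) * (azParam (ZMod p) ^ (n + 1) *
      (mk fun i ↦ coeff (i + (n + 1)) (quarticSeries p)).subst (azParam (ZMod p)))) = 0 := by
    -- X divides `azParam`, so the terms of index above n cannot reach degree n.
    refine X_pow_dvd_iff.mp (?_ : X ^ (n + 1) ∣ _) n (Nat.lt_succ_self n)
    refine ((pow_dvd_pow_of_dvd ?_ (n + 1)).mul_right _).mul_left _
    exact (dvd_pow_self X three_ne_zero).mul_right _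
  rw [hz, zero_add, trunc_apply, Finset.range_eq_Ico, map_sum, Finset.mul_sum, map_sum]
  push_cast
  refine Finset.sum_congr rfl fun k _ => ?_
  rw [Polynomial.aeval_monomial, azParam, quarticSeries, coeff_mk, mul_pow, ← pow_mul, ← pow_mul]
  have : invOneAdd (ZMod p) * (algebraMap (ZMod p) (ZMod p)⟦X⟧ (quarticCoeff k : ZMod p) *
      (X ^ (3 * k) * invOneAdd (ZMod p) ^ (4 * k))) =
      C (quarticCoeff k : ZMod p) * (X ^ (3 * k) * invOneAdd (ZMod p) ^ (4 * k + 1)) := by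
    rw [show algebraMap (ZMod p) (ZMod p)⟦X⟧ = C from rfl]; ring
  rw [this, coeff_C_mul, coeff_X_pow_mul']
  split_ifs with h
  · rw [coeff_invOneAdd_pow, show 4 * k + (n - 3 * k) = n + k by omega]
  · rw [mul_zero]

/-! ### The functional equation f = A f^p -/

section

variable {p : ℕ} [Fact p.Prime]

theorem coeff_pow_char (f : (ZMod p)⟦X⟧) (n : ℕ) :
    coeff n (f ^ p) = if p ∣ n then coeff (n / p) f else 0 := by
  have h := MvPowerSeries.map_frobenius_expand (R := ZMod p) (σ := Unit) p
    (Fact.out : p.Prime).ne_zero (f := f)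
  rw [ZMod.frobenius_zmod, MvPowerSeries.map_id] at h
  have h' : f.expand p (Fact.out : p.Prime).ne_zero = f ^ p := h
  rw [← h', coeff_expand]

/-- The p-th power only has exponents divisible by p, so Euclidean division of n by p leaves one
term in the product, and the Lucas congruence evaluates it. -/
theorem quarticSeries_eq :
    quarticSeries p = (quarticTrunc p : (ZMod p)⟦X⟧) * quarticSeries p ^ p := by
  have hpos : 0 < p := (Fact.out : p.Prime).pos
  ext n
  rw [coeff_mul, Finset.sum_eq_single (n % p, p * (n / p))]
  · rw [Polynomial.coeff_coe, coeff_quarticTrunc_of_lt (Nat.mod_lt _ hpos), coeff_pow_char,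
      if_pos (dvd_mul_right _ _), Nat.mul_div_cancel_left _ hpos, quarticSeries, coeff_mk, coeff_mk,
      ← quarticCoeff_add_mul_cast _ _ (Nat.mod_lt _ hpos), Nat.mod_add_div]
  · rintro ⟨i, j⟩ hij hne
    rw [Finset.HasAntidiagonal.mem_antidiagonal] at hij
    simp only at hij
    rw [Polynomial.coeff_coe, coeff_quarticTrunc, coeff_pow_char]
    split_ifs with h1 h2
    · exfalso
      apply hne
      obtain ⟨l, rfl⟩ := h2
      have hi : i < p := by omega
      subst hij
      rw [Nat.add_mul_mod_self_left, Nat.mod_eq_of_lt hi, Nat.add_mul_div_left _ _ hpos,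
        Nat.div_eq_of_lt hi, zero_add]
    all_goals simp
  · intro h
    exact absurd (Finset.HasAntidiagonal.mem_antidiagonal.mpr (Nat.mod_add_div n p)) h

end

section

variable {R : Type*} [CommRing R]

/-- The polynomial `(1 + 3X)^N G(X³ / (1 + 3X)⁴)`, for `G` of degree at most `N / 4`. -/
noncomputable def azHomog (N : ℕ) (G : R[X]) : R[X] :=
  ∑ k ∈ Finset.range (G.natDegree + 1), Polynomial.C (G.coeff k) *
    (Polynomial.X ^ (3 * k) * (1 + 3 * Polynomial.X) ^ (N - 4 * k))

theorem one_add_pow_mul_invOneAdd_pow (n : ℕ) :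
    (1 + 3 * X : R⟦X⟧) ^ n * invOneAdd R ^ n = 1 := by
  rw [← mul_pow, mul_comm, invOneAdd_mul, one_pow]

theorem coe_azHomog {N : ℕ} {G : R[X]} (hG : 4 * G.natDegree ≤ N) :
    (azHomog N G : R⟦X⟧) = (1 + 3 * X) ^ N * Polynomial.aeval (azParam R) G := by
  rw [azHomog, Polynomial.aeval_eq_sum_range, ← Polynomial.coeToPowerSeries.ringHom_apply, map_sum,
    Finset.mul_sum]
  refine Finset.sum_congr rfl fun k hk => ?_
  have hk' : 4 * k ≤ N := by rw [Finset.mem_range] at hk; omega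
  simp only [map_mul, map_pow, map_add, map_one, map_ofNat,
    Polynomial.coeToPowerSeries.ringHom_apply, Polynomial.coe_C, Polynomial.coe_X, azParam,
    smul_eq_C_mul]
  have h := one_add_pow_mul_invOneAdd_pow (R := R) (4 * k)
  rw [mul_pow, ← pow_mul, ← pow_mul]
  conv_rhs => rw [show N = (N - 4 * k) + 4 * k by omega, pow_add]
  linear_combination (-C (G.coeff k) * X ^ (3 * k) * (1 + 3 * X) ^ (N - 4 * k)) * h

theorem natDegree_one_add_pow_le (n : ℕ) :
    ((1 + 3 * Polynomial.X : R[X]) ^ n).natDegree ≤ n := by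
  refine Polynomial.natDegree_pow_le.trans ?_
  have : (1 + 3 * Polynomial.X : R[X]).natDegree ≤ 1 := by
    rw [← map_ofNat Polynomial.C 3]
    refine (Polynomial.natDegree_add_le _ _).trans (max_le (by simp) ?_)
    exact (Polynomial.natDegree_C_mul_le _ _).trans Polynomial.natDegree_X_le
  nlinarith

theorem natDegree_azHomog_le {N : ℕ} {G : R[X]} (hG : 4 * G.natDegree ≤ N) :
    (azHomog N G).natDegree ≤ N := by
  refine Polynomial.natDegree_sum_le_of_forall_le _ _ fun k hk => ?_
  have hk' : 4 * k ≤ N := by rw [Finset.mem_range] at hk; omega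
  refine (Polynomial.natDegree_C_mul_le _ _).trans ?_
  refine (Polynomial.natDegree_mul_le_of_le (Polynomial.natDegree_X_pow_le _)
    (natDegree_one_add_pow_le _)).trans ?_
  omega

/-- The k-th summand has degree at most N - k, so only k = 0 contributes. -/
theorem coeff_azHomog_self {N : ℕ} {G : R[X]} (hG : 4 * G.natDegree ≤ N) :
    (azHomog N G).coeff N = G.coeff 0 * 3 ^ N := by
  rw [azHomog, Polynomial.finsetSum_coeff, Finset.sum_eq_single 0]
  · have := Polynomial.coeff_pow_of_natDegree_le (m := N) (n := 1)
      (p := (1 + 3 * Polynomial.X : R[X])) (by simpa using natDegree_one_add_pow_le (R := R) 1)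
    rw [mul_one] at this
    simp only [mul_zero, pow_zero, one_mul, tsub_zero, Polynomial.coeff_C_mul, this]
    rw [← map_ofNat Polynomial.C 3]
    simp [Polynomial.coeff_one]
  · intro k hk hk0
    have hk' : 4 * k ≤ N := by rw [Finset.mem_range] at hk; omega
    apply Polynomial.coeff_eq_zero_of_natDegree_lt
    refine lt_of_le_of_lt ((Polynomial.natDegree_C_mul_le _ _).trans
      (Polynomial.natDegree_mul_le_of_le (Polynomial.natDegree_X_pow_le _)
        (natDegree_one_add_pow_le _))) ?_
    omega
  · simp

end

section

variable {p : ℕ} [Fact p.Prime]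

theorem four_mul_natDegree_quarticTrunc_le : 4 * (quarticTrunc p).natDegree ≤ p - 1 := by
  have : ¬ 4 ∣ p := by
    rintro ⟨l, hl⟩
    have := (Nat.prime_dvd_prime_iff_eq Nat.prime_two (Fact.out : p.Prime)).mp ⟨2 * l, by omega⟩
    omega
  rw [natDegree_quarticTrunc]
  omega

theorem azPowerSeries_eq_mul_pow :
    azPowerSeries p = (azHomog (p - 1) (quarticTrunc p) : (ZMod p)⟦X⟧) * azPowerSeries p ^ p := by
  have hy := hasSubst_azParam (ZMod p)
  have hpos : 0 < p := (Fact.out : p.Prime).pos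
  have h := congrArg (PowerSeries.subst (azParam (ZMod p))) (quarticSeries_eq (p := p))
  rw [subst_mul hy, subst_pow hy, subst_coe hy] at h
  rw [azPowerSeries_eq_subst, coe_azHomog (four_mul_natDegree_quarticTrunc_le (p := p)), mul_pow]
  have h1 := one_add_pow_mul_invOneAdd_pow (R := ZMod p) (p - 1)
  have h2 : invOneAdd (ZMod p) ^ p = invOneAdd (ZMod p) ^ (p - 1) * invOneAdd (ZMod p) := by
    rw [← pow_succ, Nat.sub_add_cancel hpos]
  rw [h2]
  set s := PowerSeries.subst (azParam (ZMod p)) (quarticSeries p)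
  set t := Polynomial.aeval (azParam (ZMod p)) (quarticTrunc p)
  calc invOneAdd (ZMod p) * s = ((1 + 3 * X) ^ (p - 1) * invOneAdd (ZMod p) ^ (p - 1)) *
        (invOneAdd (ZMod p) * s) := by rw [h1, one_mul]
    _ = ((1 + 3 * X) ^ (p - 1) * invOneAdd (ZMod p) ^ (p - 1)) *
        (invOneAdd (ZMod p) * (t * s ^ p)) := by rw [← h]
    _ = _ := by ring

/-- The p-th power of the series is 1 + O(t^p), so a factor of degree less than p must be the
truncation. -/
theorem azTrunc_eq_azHomog : azTrunc p = azHomog (p - 1) (quarticTrunc p) := by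
  have hpos : 0 < p := (Fact.out : p.Prime).pos
  ext n
  have h1 : (azTrunc p).coeff n = if n < p then (azNumber n : ZMod p) else 0 := by
    simp [azTrunc, Polynomial.coeff_X_pow]
  rw [h1]
  split_ifs with hn
  · have h := congrArg (coeff n) (azPowerSeries_eq_mul_pow (p := p))
    rw [coeff_mul, Finset.sum_eq_single (n, 0)] at h
    · rw [Polynomial.coeff_coe, coeff_pow_char, if_pos (dvd_zero _), Nat.zero_div] at h
      have h0 : coeff 0 (azPowerSeries p) = 1 := by
        simp [azPowerSeries, azNumber]
      rw [h0, mul_one] at h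
      rw [← h, azPowerSeries, coeff_mk]
    · rintro ⟨i, j⟩ hij hne
      rw [Finset.HasAntidiagonal.mem_antidiagonal] at hij
      simp only at hij
      rw [coeff_pow_char, if_neg, mul_zero]
      intro hd
      have : j = 0 := Nat.eq_zero_of_dvd_of_lt hd (by omega)
      exact hne (by simp only [Prod.mk.injEq]; omega)
    · intro h'
      exact absurd (Finset.HasAntidiagonal.mem_antidiagonal.mpr (add_zero n)) h'
  · rw [Polynomial.coeff_eq_zero_of_natDegree_lt]
    have := natDegree_azHomog_le (four_mul_natDegree_quarticTrunc_le (p := p))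
    omega

theorem azPowerSeries_eq_azTrunc_mul_pow :
    azPowerSeries p = (azTrunc p : (ZMod p)⟦X⟧) * azPowerSeries p ^ p := by
  rw [azTrunc_eq_azHomog]
  exact azPowerSeries_eq_mul_pow

theorem coe_azTrunc : (azTrunc p : (ZMod p)⟦X⟧) =
    (1 + 3 * X) ^ (p - 1) * Polynomial.aeval (azParam (ZMod p)) (quarticTrunc p) := by
  rw [azTrunc_eq_azHomog, coe_azHomog four_mul_natDegree_quarticTrunc_le]

theorem natDegree_azTrunc_lt : (azTrunc p).natDegree < p := by
  have h := natDegree_azHomog_le (four_mul_natDegree_quarticTrunc_le (p := p))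
  have hpos : 0 < p := (Fact.out : p.Prime).pos
  rw [azTrunc_eq_azHomog]
  omega

theorem coeff_azTrunc_sub_one (hp : 3 < p) : (azTrunc p).coeff (p - 1) = 1 := by
  have h3 : (3 : ZMod p) ≠ 0 := by
    have : ((3 : ℕ) : ZMod p) ≠ 0 := by
      rw [Ne, ZMod.natCast_eq_zero_iff]
      intro h
      have := Nat.le_of_dvd (by omega) h
      omega
    simpa using this
  rw [azTrunc_eq_azHomog, coeff_azHomog_self four_mul_natDegree_quarticTrunc_le,
    coeff_zero_quarticTrunc, one_mul, ZMod.pow_card_sub_one_eq_one h3]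

theorem coeff_zero_azTrunc : (azTrunc p).coeff 0 = 1 := by
  have hpos : 0 < p := (Fact.out : p.Prime).pos
  simp [azTrunc, Polynomial.coeff_X_pow, hpos, azNumber]

end

end

/-! ### Pulling back the first integral and the factorization -/

section

open PowerSeries

/-- The Euler operator `X d/dX` on power series. -/
noncomputable def PowerSeries.euler (R : Type*) [CommRing R] : Derivation R R⟦X⟧ R⟦X⟧ :=
  (X : R⟦X⟧) • derivative R

theorem PowerSeries.euler_apply {R : Type*} [CommRing R] (f : R⟦X⟧) :
    euler R f = X * derivative R f := rfl

theorem PowerSeries.euler_coe {R : Type*} [CommRing R] (f : R[X]) :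
    euler R (f : R⟦X⟧) = (Polynomial.euler R f : R[X]) := by
  rw [euler_apply, derivative_coe, Polynomial.euler_apply, Polynomial.coe_mul, Polynomial.coe_X]

theorem PowerSeries.euler_X {R : Type*} [CommRing R] : euler R (X : R⟦X⟧) = X := by
  simp [euler_apply]

theorem PowerSeries.euler_ofNat {R : Type*} [CommRing R] (r : ℕ) [r.AtLeastTwo] :
    euler R (ofNat(r) : R⟦X⟧) = 0 :=
  (euler R).map_natCast r

theorem coe_firstIntegral {R : Type*} [CommRing R] (Q S A : R[X]) :
    ((firstIntegral (Polynomial.euler R) Q S A : R[X]) : R⟦X⟧) =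
      firstIntegral (PowerSeries.euler R) (Q : R⟦X⟧) S A := by
  simp only [firstIntegral, PowerSeries.euler_coe]
  have h2 : ((2 : R[X]) : R⟦X⟧) = 2 := map_ofNat Polynomial.coeToPowerSeries.ringHom 2
  simp only [Polynomial.coe_add, Polynomial.coe_mul, Polynomial.coe_sub, Polynomial.coe_pow, h2]

theorem euler_invOneAdd (R : Type*) [CommRing R] :
    PowerSeries.euler R (invOneAdd R) = -3 * X * invOneAdd R ^ 2 := by
  have h := invOneAdd_mul R
  have h' := congrArg (PowerSeries.euler R) h
  simp only [Derivation.leibniz, map_add, Derivation.map_one_eq_zero, PowerSeries.euler_X,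
    PowerSeries.euler_ofNat, smul_eq_mul] at h'
  linear_combination invOneAdd R * h' - PowerSeries.euler R (invOneAdd R) * h

theorem euler_azParam (R : Type*) [CommRing R] :
    PowerSeries.euler R (azParam R) = 3 * (1 - X) * invOneAdd R * azParam R := by
  have h := invOneAdd_mul R
  simp only [azParam, Derivation.leibniz, Derivation.leibniz_pow, PowerSeries.euler_X,
    euler_invOneAdd, smul_eq_mul, nsmul_eq_mul]
  push_cast
  linear_combination (-3 * X ^ 3 * invOneAdd R ^ 4) * h

theorem euler_aeval_azParam {R : Type*} [CommRing R] (f : R[X]) :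
    PowerSeries.euler R (Polynomial.aeval (azParam R) f) =
      3 * (1 - X) * invOneAdd R * Polynomial.aeval (azParam R) (Polynomial.euler R f) := by
  rw [Derivation.map_aeval, euler_azParam, Polynomial.euler_apply, map_mul, Polynomial.aeval_X,
    smul_eq_mul]
  ring

theorem one_add_pow_four_mul_one_sub_azParam (R : Type*) [CommRing R] :
    (1 + 3 * X : R⟦X⟧) ^ 4 * (1 - 256 * azParam R) =
      (81 * X ^ 2 + 14 * X + 1) * (1 - X) ^ 2 := by
  have h := one_add_pow_mul_invOneAdd_pow (R := R) 4
  rw [azParam]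
  linear_combination (-256 * X ^ 3) * h

section

variable {p : ℕ} [Fact p.Prime]

/-- In characteristic p, (1+3X)^p is a constant for the Euler operator, so A is a constant times
`invOneAdd` times F₀(y). The first integral of A is then 9(1+3X)^(2p) times that of F₀ at y, the 9
coming from the 3 in `euler_azParam`. -/
theorem firstIntegral_azTrunc (hp : p ≠ 2) :
    firstIntegral (Polynomial.euler (ZMod p))
      (81 * Polynomial.X ^ 2 + 14 * Polynomial.X + 1) (81 * Polynomial.X ^ 2 + 6 * Polynomial.X)
      (azTrunc p) = 0 := by
  have hpos : 0 < p := (Fact.out : p.Prime).pos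
  apply Polynomial.coe_injective
  have hc (r : ℕ) [r.AtLeastTwo] : ((OfNat.ofNat r : (ZMod p)[X]) : (ZMod p)⟦X⟧) = OfNat.ofNat r :=
    map_ofNat Polynomial.coeToPowerSeries.ringHom r
  rw [coe_firstIntegral, Polynomial.coe_zero, coe_azTrunc]
  simp only [Polynomial.coe_add, Polynomial.coe_mul, Polynomial.coe_pow, Polynomial.coe_X,
    Polynomial.coe_one, hc]
  have hw : PowerSeries.euler (ZMod p) ((1 + 3 * X : (ZMod p)⟦X⟧) ^ p) = 0 := by
    have hp0 : (p : (ZMod p)⟦X⟧) = 0 := by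
      rw [← map_natCast (C (R := ZMod p)), CharP.cast_eq_zero, map_zero]
    rw [Derivation.leibniz_pow, nsmul_eq_mul, hp0, zero_mul]
  have hQ : PowerSeries.euler (ZMod p) (81 * X ^ 2 + 14 * X + 1 : (ZMod p)⟦X⟧) =
      162 * X ^ 2 + 14 * X := by
    simp only [map_add, Derivation.leibniz, Derivation.leibniz_pow, PowerSeries.euler_X,
      PowerSeries.euler_ofNat, smul_eq_mul, nsmul_eq_mul, Derivation.map_one_eq_zero]
    push_cast
    ring
  have e := invOneAdd_mul (ZMod p)
  have hA : (1 + 3 * X : (ZMod p)⟦X⟧) ^ (p - 1) = (1 + 3 * X) ^ p * invOneAdd (ZMod p) := by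
    have hs : (1 + 3 * X : (ZMod p)⟦X⟧) ^ p = (1 + 3 * X) ^ (p - 1) * (1 + 3 * X) := by
      rw [← pow_succ, Nat.sub_add_cancel hpos]
    rw [hs]
    linear_combination (-(1 + 3 * X : (ZMod p)⟦X⟧) ^ (p - 1)) * e
  have hI := congrArg (Polynomial.aeval (azParam (ZMod p))) (firstIntegral_quarticTrunc hp)
  have hQ' : Polynomial.euler (ZMod p) (1 - 256 * Polynomial.X) = -256 * Polynomial.X := by
    simp [Polynomial.euler_apply, mul_comm]
  simp only [firstIntegral, hQ', map_add, map_mul, map_sub, map_pow, map_neg, map_ofNat, map_one,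
    Polynomial.aeval_X, map_zero] at hI
  have h4 := one_add_pow_four_mul_one_sub_azParam (ZMod p)
  have h5 := one_add_pow_mul_invOneAdd_pow (R := ZMod p) 4
  rw [hA]
  simp only [firstIntegral, hQ, Derivation.leibniz, hw, euler_aeval_azParam, euler_invOneAdd,
    smul_eq_mul, Derivation.leibniz_pow, map_sub, map_add, map_neg, Derivation.map_one_eq_zero,
    PowerSeries.euler_X, PowerSeries.euler_ofNat, nsmul_eq_mul, map_zero]
  push_cast
  generalize Polynomial.aeval (azParam (ZMod p)) (Polynomial.euler (ZMod p)
    (Polynomial.euler (ZMod p) (quarticTrunc p))) = h2 at *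
  generalize Polynomial.aeval (azParam (ZMod p)) (Polynomial.euler (ZMod p)
    (quarticTrunc p)) = h1 at *
  generalize Polynomial.aeval (azParam (ZMod p)) (quarticTrunc p) = h0 at *
  rw [azParam] at hI
  generalize (1 + 3 * X : (ZMod p)⟦X⟧) ^ p = w at *
  generalize invOneAdd (ZMod p) = v at *
  generalize (X : (ZMod p)⟦X⟧) = t at *
  linear_combination (9 * w ^ 2) * hI
    + (9 * w ^ 2 * (2 * h0 * h2 - h1 ^ 2)) * h5
    - (w ^ 2 * (h0 ^ 2 * (-6 * t * (81 * t ^ 2 + 14 * t + 1) - 3 * t * (162 * t ^ 2 + 14 * t))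
      + h0 * h1 * (-6 * t * (81 * t ^ 2 + 14 * t + 1) + 3 * (162 * t ^ 2 + 14 * t) * (1 - t)))
        * v ^ 3) * e
    - (w ^ 2 * h0 ^ 2 * (6 * t + 81 * t ^ 2) * v ^ 2 * (v * (1 + 3 * t) + 1)) * e

theorem exists_azTrunc_eq (hp : p ≠ 2) :
    ∃ B : (ZMod p)[X], (p % 8 = 1 ∨ p % 8 = 3 → azTrunc p = B ^ 2) ∧
      (p % 8 = 5 ∨ p % 8 = 7 → azTrunc p =
        (81 * Polynomial.X ^ 2 + 14 * Polynomial.X + 1) * B ^ 2) := by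
  obtain ⟨G, hG1, hG2⟩ := exists_quarticTrunc_eq hp
  have hdeg := natDegree_quarticTrunc (p := p)
  have hc (r : ℕ) [r.AtLeastTwo] : ((OfNat.ofNat r : (ZMod p)[X]) : (ZMod p)⟦X⟧) = OfNat.ofNat r :=
    map_ofNat Polynomial.coeToPowerSeries.ringHom r
  by_cases h : p % 8 = 1 ∨ p % 8 = 3
  · have hH := hG1 (by rw [Nat.even_iff]; omega)
    rw [hH, Polynomial.natDegree_pow] at hdeg
    refine ⟨azHomog ((p - 1) / 2) G, fun _ => ?_, fun h' => by omega⟩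
    apply Polynomial.coe_injective
    rw [coe_azTrunc, Polynomial.coe_pow, coe_azHomog (by omega), hH, map_pow, mul_pow, ← pow_mul,
      show (p - 1) / 2 * 2 = p - 1 by omega]
  · by_cases h' : p % 8 = 5 ∨ p % 8 = 7
    · have hH := hG2 (by rw [Nat.odd_iff]; omega)
      have hG0 : G ≠ 0 := by
        rintro rfl
        have := coeff_zero_quarticTrunc (p := p)
        rw [hH] at this
        simp at this
      have hdeg' : 2 * G.natDegree + 1 = p / 4 := by
        rw [← hdeg, hH, Polynomial.natDegree_mul _ (pow_ne_zero _ hG0), Polynomial.natDegree_pow,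
          natDegree_one_sub_mul_X hp, add_comm]
        intro h0
        have := natDegree_one_sub_mul_X hp
        rw [h0] at this
        simp at this
      -- The factor 1 - 256y uses up four of the p - 1 powers of 1 + 3X and contributes (1 - X)².
      refine ⟨(1 - Polynomial.X) * azHomog ((p - 5) / 2) G, fun h'' => by omega, fun _ => ?_⟩
      apply Polynomial.coe_injective
      have h4 := one_add_pow_four_mul_one_sub_azParam (ZMod p)
      rw [coe_azTrunc, hH]
      simp only [Polynomial.coe_mul, Polynomial.coe_pow, Polynomial.coe_sub, Polynomial.coe_add,
        Polynomial.coe_one, Polynomial.coe_X, hc]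
      rw [coe_azHomog (by omega), show p - 1 = (p - 5) / 2 * 2 + 4 by omega, pow_add, pow_mul]
      simp only [map_mul, map_sub, map_one, map_ofNat, map_pow, Polynomial.aeval_X]
      linear_combination (((1 + 3 * X) ^ ((p - 5) / 2)) ^ 2 *
        Polynomial.aeval (azParam (ZMod p)) G ^ 2) * h4
    · exact ⟨0, fun h'' => absurd h'' h, fun h'' => absurd h'' h'⟩

theorem not_sq_dvd_quadratic (hp : p ≠ 2) {π : (ZMod p)[X]} (hπ : Irreducible π) :
    ¬ π ^ 2 ∣ 81 * Polynomial.X ^ 2 + 14 * Polynomial.X + 1 := by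
  rintro ⟨R, hR⟩
  have hder := congrArg Polynomial.derivative hR
  have hd : Polynomial.derivative (81 * Polynomial.X ^ 2 + 14 * Polynomial.X + 1 : (ZMod p)[X]) =
      162 * Polynomial.X + 14 := by
    simp only [Polynomial.derivative_add, Polynomial.derivative_mul, Polynomial.derivative_ofNat,
      Polynomial.derivative_X_pow, Polynomial.derivative_X, Polynomial.derivative_one]
    simp only [Nat.cast_ofNat, map_ofNat]
    ring
  rw [hd, Polynomial.derivative_mul, Polynomial.derivative_sq] at hder
  -- The discriminant of the quadratic is 14² - 4·81 = -2⁷.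
  have h128 : π ∣ (2 : (ZMod p)[X]) ^ 7 := by
    rw [show (Polynomial.C (2 : ZMod p)) = 2 from map_ofNat _ 2] at hder
    refine ⟨324 * π * R - (162 * Polynomial.X + 14) *
      (2 * Polynomial.derivative π * R + π * Polynomial.derivative R), ?_⟩
    linear_combination 324 * hR - (162 * Polynomial.X + 14) * hder
  have h2 : π ∣ Polynomial.C (2 : ZMod p) := by
    rw [map_ofNat]; exact hπ.prime.dvd_of_dvd_pow h128
  refine hπ.not_isUnit (isUnit_of_dvd_unit h2 (Polynomial.isUnit_C.mpr (isUnit_iff_ne_zero.mpr ?_)))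
  exact two_ne_zero_zmod hp

/-- An exponent `e` such that the truncation is an `e`-th power is at most `2`, and it is `1` if
the truncation vanishes at a zero of `81 X² + 14 X + 1`. -/
theorem exponent_le_of_pow_eq_azTrunc (hp : p ≠ 2) {D π : (ZMod p)[X]} {e : ℕ}
    (hD : D ^ e = azTrunc p) (hπ : Irreducible π) (hπD : π ∣ D) :
    e ≤ 2 ∧ (π ∣ 81 * Polynomial.X ^ 2 + 14 * Polynomial.X + 1 → e ≤ 1) := by
  have hA : azTrunc p ≠ 0 := by
    intro h
    have := coeff_zero_azTrunc (p := p)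
    rw [h] at this
    simp at this
  have hfin := FiniteMultiplicity.of_prime_left hπ.prime hA
  obtain ⟨E, hE, hEd⟩ := hfin.exists_eq_pow_mul_and_not_dvd
  have hle : e ≤ multiplicity π (azTrunc p) :=
    hfin.le_multiplicity_of_pow_dvd (hD ▸ pow_dvd_pow_of_dvd hπD e)
  rcases Nat.eq_zero_or_pos e with rfl | hpos
  · exact ⟨by omega, fun _ => by omega⟩
  have hkey := Polynomial.dvd_or_eq_of_firstIntegral_eq_zero
    (by rw [coeff_zero_azTrunc]; exact one_ne_zero) natDegree_azTrunc_lt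
    (firstIntegral_azTrunc hp) hp hπ hE hEd (by omega)
  have h1 := fun h => hkey.2 h (not_sq_dvd_quadratic hp hπ)
  refine ⟨?_, fun h => (h1 h) ▸ hle⟩
  rcases hkey.1 with h | h
  · have := h1 h; omega
  · omega

/-- The leading coefficient 3^(p-1) = 1 makes A nonconstant, so D has an irreducible factor. -/
theorem exponent_le_two (hp : 3 < p) {D : (ZMod p)[X]} {e : ℕ}
    (hD : D ^ e = azTrunc p) : e ≤ 2 := by
  have hdeg : p - 1 ≤ (azTrunc p).natDegree :=
    Polynomial.le_natDegree_of_ne_zero (by rw [coeff_azTrunc_sub_one hp]; exact one_ne_zero)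
  rw [← hD, Polynomial.natDegree_pow] at hdeg
  obtain ⟨π, hπ, hd⟩ := Polynomial.exists_irreducible_of_natDegree_ne_zero (f := D) (by
    intro h
    rw [h] at hdeg
    omega)
  exact (exponent_le_of_pow_eq_azTrunc (by omega) hD hπ hd).1

theorem exponent_le_one (hp : 3 < p) {B D : (ZMod p)[X]} {e : ℕ} (hD : D ^ e = azTrunc p)
    (hB : azTrunc p = (81 * Polynomial.X ^ 2 + 14 * Polynomial.X + 1) * B ^ 2) : e ≤ 1 := by
  have h81 : (81 : ZMod p) ≠ 0 := by
    have : ((3 : ℕ) : ZMod p) ≠ 0 := by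
      rw [Ne, ZMod.natCast_eq_zero_iff]
      intro h
      have := Nat.le_of_dvd (by omega) h
      omega
    rw [show (81 : ZMod p) = ((3 : ℕ) : ZMod p) ^ 4 by norm_num]
    exact pow_ne_zero _ this
  have hdeg : (81 * Polynomial.X ^ 2 + 14 * Polynomial.X + 1 : (ZMod p)[X]).natDegree = 2 := by
    have := Polynomial.natDegree_quadratic (b := (14 : ZMod p)) (c := 1) h81
    simpa only [map_ofNat, map_one] using this
  obtain ⟨π, hπ, hd⟩ := Polynomial.exists_irreducible_of_natDegree_ne_zero
    (f := (81 * Polynomial.X ^ 2 + 14 * Polynomial.X + 1 : (ZMod p)[X])) (by omega)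
  have hπD : π ∣ D := by
    refine hπ.prime.dvd_of_dvd_pow (n := e) ?_
    rw [hD, hB]
    exact hd.mul_right _
  exact (exponent_le_of_pow_eq_azTrunc (by omega) hD hπ hπD).2 hd

end

end

/-! ### Kummer theory and the Galois group -/

/-- Kummer theory for the exponent `p - 1` over a field containing `𝔽_p`: the Galois group embeds
in `𝔽_p^×`, and the radicand is a power with exponent the index of the image. -/
theorem kummer_sub_one {p : ℕ} [Fact p.Prime] {K E : Type*} [Field K] [Field E] [Algebra K E]
    (c : ZMod p →+* K) {g : E} {a : K} (ha : g ^ (p - 1) = algebraMap K E a) (hg : g ≠ 0)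
    (htop : IntermediateField.adjoin K {g} = ⊤) :
    IsGalois K E ∧ ∃ φ : (E ≃ₐ[K] E) →* (ZMod p)ˣ, Function.Injective φ ∧
      (∀ σ : E ≃ₐ[K] E, σ g / g = algebraMap K E (c (φ σ : (ZMod p)ˣ))) ∧
      (∃ r : K, r ^ φ.range.index = a) ∧
      ∀ (n : ℕ) (b : K), g ^ n = algebraMap K E b → ∀ σ, φ σ ^ n = 1 := by
  have hp : p.Prime := Fact.out
  have hcard : Nat.card (ZMod p)ˣ = p - 1 := by
    rw [Nat.card_eq_fintype_card, ZMod.card_units]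
  have hp1 : p - 1 ≠ 0 := by have := hp.two_le; omega
  obtain ⟨u, hu⟩ := IsCyclic.exists_generator (α := (ZMod p)ˣ)
  have huord : orderOf u = p - 1 := by rw [orderOf_eq_card_of_forall_mem_zpowers hu, hcard]
  have hu' : IsPrimitiveRoot (u : ZMod p) (p - 1) := by
    rw [IsPrimitiveRoot.coe_units_iff, ← huord]
    exact IsPrimitiveRoot.orderOf u
  have hζ : IsPrimitiveRoot (c u) (p - 1) := hu'.map_of_injective c.injective
  have hζE : IsPrimitiveRoot (algebraMap K E (c u)) (p - 1) :=
    hζ.map_of_injective (algebraMap K E).injective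
  have ha0 : a ≠ 0 := by
    rintro rfl
    rw [map_zero] at ha
    exact pow_ne_zero _ hg ha
  have hp1K : ((p - 1 : ℕ) : K) ≠ 0 := by
    have h := c.injective.ne (a₁ := ((p - 1 : ℕ) : ZMod p)) (a₂ := 0) (by
      rw [Ne, ZMod.natCast_eq_zero_iff]
      intro h
      have := Nat.le_of_dvd (Nat.pos_of_ne_zero hp1) h
      omega)
    simpa using h
  have hsplit : (Polynomial.X ^ (p - 1) - Polynomial.C a).IsSplittingField K E := by
    rw [isSplittingField_iff_intermediateField]
    constructor
    · rw [Polynomial.map_sub, Polynomial.map_pow, Polynomial.map_X, Polynomial.map_C]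
      exact X_pow_sub_C_splits_of_isPrimitiveRoot hζE ha
    · rw [eq_top_iff, ← htop]
      apply IntermediateField.adjoin.mono
      rw [Set.singleton_subset_iff, Polynomial.mem_rootSet]
      exact ⟨Polynomial.X_pow_sub_C_ne_zero (Nat.pos_of_ne_zero hp1) a, by simp [ha]⟩
  have hgal : IsGalois K E := IsGalois.of_separable_splitting_field
    (p := Polynomial.X ^ (p - 1) - Polynomial.C a) (Polynomial.separable_X_pow_sub_C a hp1K ha0)
  have hfin : FiniteDimensional K E :=
    Polynomial.IsSplittingField.finiteDimensional E (Polynomial.X ^ (p - 1) - Polynomial.C a)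
  refine ⟨hgal, ?_⟩
  have hex : ∀ σ : E ≃ₐ[K] E, ∃ v : (ZMod p)ˣ, σ g = algebraMap K E (c (v : ZMod p)) * g := by
    intro σ
    have : (σ g / g) ^ (p - 1) = 1 := by
      rw [div_pow, ← map_pow, ha, AlgEquiv.commutes, div_self]
      exact (map_ne_zero _).mpr ha0
    have hne : NeZero (p - 1) := ⟨hp1⟩
    obtain ⟨i, -, hi⟩ := hζE.eq_pow_of_pow_eq_one this
    refine ⟨u ^ i, ?_⟩
    rw [Units.val_pow_eq_pow_val, map_pow, map_pow, hi, div_mul_cancel₀ _ hg]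
  choose f hf using hex
  have hcE : Function.Injective fun v : (ZMod p)ˣ => algebraMap K E (c (v : ZMod p)) :=
    (algebraMap K E).injective.comp (c.injective.comp Units.val_injective)
  let φ : (E ≃ₐ[K] E) →* (ZMod p)ˣ := MonoidHom.mk' f fun σ τ => hcE (by
    apply mul_right_cancel₀ hg
    simp only
    rw [← hf, AlgEquiv.mul_apply, hf τ, map_mul, AlgEquiv.commutes, hf σ, Units.val_mul, map_mul,
      map_mul]
    ring)
  have hφ : ∀ σ, σ g = algebraMap K E (c (φ σ : (ZMod p)ˣ)) * g := hf
  have hpow : ∀ (n : ℕ) σ, σ (g ^ n) = algebraMap K E (c ((φ σ ^ n : (ZMod p)ˣ) : ZMod p)) * g ^ n := by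
    intro n σ
    rw [map_pow, hφ, mul_pow, Units.val_pow_eq_pow_val, map_pow, map_pow]
  refine ⟨φ, ?_, ?_, ?_, ?_⟩
  · rw [injective_iff_map_eq_one]
    intro σ hσ
    have h1 : σ g = g := by rw [hφ, hσ]; simp
    have h2 : IntermediateField.adjoin K {g} ≤
        IntermediateField.fixedField (Subgroup.zpowers σ) := by
      rw [IntermediateField.adjoin_le_iff, Set.singleton_subset_iff]
      rintro ⟨τ, i, rfl⟩
      exact (MulAction.mem_stabilizer_iff.mp
        ((MulAction.stabilizer (E ≃ₐ[K] E) g).zpow_mem (x := σ) h1 i))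
    rw [htop] at h2
    ext x
    exact h2 (IntermediateField.mem_top (x := x)) ⟨σ, Subgroup.mem_zpowers σ⟩
  · intro σ
    rw [hφ, mul_div_cancel_right₀ _ hg]
  -- With m the order of the image, g^m is fixed, hence lies in K, and its power by the index is
  -- g^(p-1) = a.
  · have hfix : ∀ σ : E ≃ₐ[K] E, σ (g ^ Nat.card φ.range) = g ^ Nat.card φ.range := by
      intro σ
      have h1 : φ σ ^ Nat.card φ.range = 1 := by
        have := pow_card_eq_one' (x := (⟨φ σ, σ, rfl⟩ : φ.range))
        simpa using congrArg Subtype.val this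
      rw [hpow, h1]
      simp
    obtain ⟨r, hr⟩ := (IsGalois.mem_range_algebraMap_iff_fixed _).mpr hfix
    refine ⟨r, (algebraMap K E).injective ?_⟩
    rw [map_pow, hr, ← pow_mul, Subgroup.card_mul_index, hcard, ha]
  · intro n b hb σ
    apply hcE
    apply mul_right_cancel₀ (pow_ne_zero n hg)
    simp only
    rw [← hpow, hb, AlgEquiv.commutes]
    simp

section

variable {p : ℕ} [Fact p.Prime]

theorem azGen_ne_zero : azGen p ≠ 0 := by
  intro h
  have h1 : azSeries p = 0 := congrArg Subtype.val h
  have h2 : azPowerSeries p = 0 :=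
    HahnSeries.ofPowerSeries_injective (h1.trans (map_zero _).symm)
  have h3 := congrArg (PowerSeries.coeff 0) h2
  simp [azPowerSeries, azNumber] at h3

theorem coe_algebraMap_azField (P : (ZMod p)[X]) :
    ((algebraMap (RatFunc (ZMod p)) (azField p) (algebraMap _ _ P) : azField p) :
      LaurentSeries (ZMod p)) = HahnSeries.ofPowerSeries ℤ (ZMod p) (P : PowerSeries (ZMod p)) := by
  have h1 : ((algebraMap (RatFunc (ZMod p)) (azField p) (algebraMap _ _ P) : azField p) :
      LaurentSeries (ZMod p)) =
      algebraMap (RatFunc (ZMod p)) (LaurentSeries (ZMod p)) (algebraMap _ _ P) := rfl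
  have h2 : algebraMap (RatFunc (ZMod p)) (LaurentSeries (ZMod p)) (algebraMap _ _ P) =
      algebraMap (ZMod p)[X] (LaurentSeries (ZMod p)) P :=
    (@IsScalarTower.algebraMap_apply (ZMod p)[X] (RatFunc (ZMod p)) (LaurentSeries (ZMod p)) _ _ _
      _ _ _ (RatFunc.isScalarTower_liftAlgebra _ _) P).symm
  rw [h1, h2, Polynomial.algebraMap_hahnSeries_apply]

theorem azGen_pow_mul : azGen p ^ (p - 1) *
    algebraMap (RatFunc (ZMod p)) (azField p) (algebraMap _ _ (azTrunc p)) = 1 := by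
  apply mul_right_cancel₀ (azGen_ne_zero (p := p))
  apply Subtype.ext
  have h := congrArg (HahnSeries.ofPowerSeries ℤ (ZMod p))
    (azPowerSeries_eq_azTrunc_mul_pow (p := p))
  rw [map_mul, map_pow] at h
  have hpos : 0 < p := (Fact.out : p.Prime).pos
  change (azSeries p) ^ (p - 1) * _ * azSeries p = _
  rw [coe_algebraMap_azField, one_mul]
  change _ = azSeries p
  have h' : azSeries p = HahnSeries.ofPowerSeries ℤ (ZMod p) (azTrunc p) * azSeries p ^ p := h
  have hs : azSeries p ^ p = azSeries p ^ (p - 1) * azSeries p := by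
    rw [← pow_succ, Nat.sub_add_cancel hpos]
  rw [hs] at h'
  linear_combination -h'

theorem adjoin_azGen : IntermediateField.adjoin (RatFunc (ZMod p)) {azGen p} = ⊤ := by
  apply IntermediateField.lift_injective
  rw [IntermediateField.lift_adjoin_simple, IntermediateField.lift_top]
  rfl

/-- The Galois extension generated by the series, with the exponent in the Kummer class. -/
theorem azField_kummer :
    ∃ φ : (azField p ≃ₐ[RatFunc (ZMod p)] azField p) →* (ZMod p)ˣ,
      AZGaloisGroupIs p φ.range ∧
      (∃ D : (ZMod p)[X], D ^ φ.range.index = azTrunc p) ∧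
      ∀ (n : ℕ) (b : RatFunc (ZMod p)),
        azGen p ^ n = algebraMap (RatFunc (ZMod p)) (azField p) b → ∀ σ, φ σ ^ n = 1 := by
  set A : RatFunc (ZMod p) := algebraMap _ _ (azTrunc p) with hA
  have ha : azGen p ^ (p - 1) = algebraMap (RatFunc (ZMod p)) (azField p) A⁻¹ := by
    rw [map_inv₀]
    exact eq_inv_of_mul_eq_one_left azGen_pow_mul
  obtain ⟨hgal, φ, hinj, hφ, ⟨r, hr⟩, hn⟩ := kummer_sub_one (RatFunc.C : ZMod p →+* _) ha
    azGen_ne_zero adjoin_azGen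
  refine ⟨φ, ⟨hgal, φ, hinj, hφ, rfl⟩, ?_, hn⟩
  have hindex : 0 < φ.range.index := Nat.pos_of_ne_zero Subgroup.index_ne_zero_of_finite
  have hr' : r⁻¹ ^ φ.range.index = A := by rw [inv_pow, hr, inv_inv]
  -- A rational function with a polynomial power is a polynomial, as 𝔽_p[t] is integrally closed.
  obtain ⟨D, hD⟩ := IsIntegrallyClosed.exists_algebraMap_eq_of_isIntegral_pow
    (R := (ZMod p)[X]) (x := r⁻¹) hindex (by rw [hr']; exact isIntegral_algebraMap)
  refine ⟨D, RatFunc.algebraMap_injective _ ?_⟩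
  rw [map_pow, hD, hr']

theorem azGaloisGroupIs_top (hp : 3 < p) {B : (ZMod p)[X]}
    (hB : azTrunc p = (81 * Polynomial.X ^ 2 + 14 * Polynomial.X + 1) * B ^ 2) :
    AZGaloisGroupIs p ⊤ := by
  obtain ⟨φ, hφ, ⟨D, hD⟩, -⟩ := azField_kummer (p := p)
  have h := exponent_le_one hp hD hB
  have h0 : φ.range.index ≠ 0 := Subgroup.index_ne_zero_of_finite
  rwa [Subgroup.index_eq_one.mp (show φ.range.index = 1 by omega)] at hφ

theorem azGaloisGroupIs_square (hp : p ≠ 2) {B : (ZMod p)[X]} (hB : azTrunc p = B ^ 2) :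
    AZGaloisGroupIs p (Subgroup.square (ZMod p)ˣ) := by
  have hp2 := (Fact.out : p.Prime).two_le
  have hodd : p % 2 = 1 := (Nat.Prime.eq_two_or_odd Fact.out).resolve_left hp
  obtain ⟨φ, hφ, ⟨D, hD⟩, hn⟩ := azField_kummer (p := p)
  -- Here f_ξ^((p-1)/2) = ±1/B is rational, so every φ(σ) satisfies Euler's criterion.
  have hle : φ.range ≤ Subgroup.square (ZMod p)ˣ := by
    have hsq : (azGen p ^ (p / 2) *
        algebraMap (RatFunc (ZMod p)) (azField p) (algebraMap _ _ B)) ^ 2 = 1 := by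
      have h := azGen_pow_mul (p := p)
      rwa [hB, map_pow, map_pow, show p - 1 = p / 2 * 2 by omega, pow_mul, ← mul_pow] at h
    have hex : ∃ b : RatFunc (ZMod p),
        azGen p ^ (p / 2) = algebraMap (RatFunc (ZMod p)) (azField p) b := by
      rcases mul_self_eq_one_iff.mp ((sq _).symm.trans hsq) with h | h
      · exact ⟨(algebraMap _ _ B)⁻¹, by rw [map_inv₀]; exact eq_inv_of_mul_eq_one_left h⟩
      · refine ⟨-(algebraMap _ _ B)⁻¹, ?_⟩
        rw [map_neg, map_inv₀, ← neg_eq_iff_eq_neg]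
        exact eq_inv_of_mul_eq_one_left (by rw [neg_mul, h, neg_neg])
    obtain ⟨b, hb⟩ := hex
    rintro _ ⟨σ, rfl⟩
    obtain ⟨y, hy⟩ := (ZMod.euler_criterion_units p (φ σ)).mpr (hn _ b hb σ)
    exact ⟨y, by rw [← hy, sq]⟩
  have hge : Subgroup.square (ZMod p)ˣ ≤ φ.range := by
    rintro _ ⟨y, rfl⟩
    rcases Nat.lt_or_ge 3 p with h3 | h3
    · have h := exponent_le_two h3 hD
      have h0 : φ.range.index ≠ 0 := Subgroup.index_ne_zero_of_finite
      rcases (show φ.range.index = 1 ∨ φ.range.index = 2 by omega) with h | h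
      · rw [Subgroup.index_eq_one.mp h]; trivial
      · exact Subgroup.mul_self_mem_of_index_two h y
    -- For p = 3 the degree argument is unavailable, but the group of squares is trivial.
    · obtain rfl : p = 3 := by omega
      have : y * y = 1 := by
        have := ZMod.units_pow_card_sub_one_eq_one 3 y
        rwa [← sq]
      rw [this]
      exact one_mem _
  rwa [le_antisymm hle hge] at hφ

end

theorem theorem4 (p : ℕ) [Fact p.Prime] :
    ∃ B : (ZMod p)[X],
      (p % 8 = 1 ∨ p % 8 = 3 →
        azTrunc p = B ^ 2 ∧ AZGaloisGroupIs p (Subgroup.square (ZMod p)ˣ)) ∧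
      (p % 8 = 5 ∨ p % 8 = 7 →
        azTrunc p = (81 * Polynomial.X ^ 2 + 14 * Polynomial.X + 1) * B ^ 2 ∧
          AZGaloisGroupIs p ⊤) := by
  by_cases hp : p = 2
  · subst hp
    exact ⟨0, by omega, by omega⟩
  · obtain ⟨B, h1, h2⟩ := exists_azTrunc_eq hp
    exact ⟨B, fun h => ⟨h1 h, azGaloisGroupIs_square hp (h1 h)⟩,
      fun h => ⟨h2 h, azGaloisGroupIs_top (by omega) (h2 h)⟩⟩
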